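/- **Theorem 1.1.** Let $\Gamma$ be a countable group acting by measure preserving Borel automorphisms on a standard probability space $(X,\mu)$. Assume that the action is faithful, i.e. only $1\in\Gamma$ acts trivially almost everywhere. Let $G=[\Gamma\curvearrowright(X,\mu)]$ be the full group, i.e. the group of measure preserving automorphisms $T$ of $(X,\mu)$ with $Tx\in\Gamma x$ for almost every $x$, modulo equality almost everywhere. For $g\in G$ put $S(g)=\{x\in X: gx\neq x\}$ (defined up to null sets), and equip $G$ with the metric $d(g,h)=\mu(S(gh^{-1}))$. View $\Gamma$ as a subgroup of $G$. A subgroup of $G$ is called discrete if its subspace topology is discrete. Suppose that at least one of the following holds: 1. $\Gamma$ is mixed identity free (MIF), i.e. for every $w\in\Gamma*\mathbb Z$ with $w\ne 1$ there is $\gamma\in\Gamma$ with $w(\gamma)\neq 1$, where $w(\gamma)$ is the value of $w$ when the generator of $\mathbb Z$ is replaced by $\gamma$; the action is weakly mixing, i.e. for every finite collection $\mathcal A$ of measurable sets and every $\varepsilon>0$ there is $\gamma\in\Gamma$ with $|\mu(\gamma A\cap B)-\mu(A)\mu(B)|<\varepsilon$ for all $A,B\in\mathcal A$; and the action is essentially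 free, i.e. $\mu(\{x:\gamma x=x\})=0$ for every $\gamma\neq1$. 2. $\Gamma$ is torsion-free and the action is mixing, i.e. for all measurable $A,B\subseteq X$ and every $\varepsilon>0$ there is a finite set $F\subset\Gamma$ with $|\mu(\gamma A\cap B)-\mu(A)\mu(B)|<\varepsilon$ for all $\gamma\in\Gamma\setminus F$. Then for every $g\in G$ with $g\neq 1$ and $\mu(S(g))<1/3$, the subgroup $\langle\Gamma,g\rangle$ of $G$ is not discrete. Moreover, $\Gamma$ is contained in a maximal discrete subgroup of $G$, i.e. in a discrete subgroup of $G$ that is not properly contained in any other discrete subgroup of $G$. -/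

import Mathlib

open MeasureTheory
open scoped Pointwise

noncomputable section

/-! Mixed identities -/

/-- Evaluation of a word `w ∈ Γ ∗ ℤ` at `g ∈ Γ`: the homomorphism `Γ ∗ ℤ → Γ` that is the identity
on `Γ` and sends the generator of `ℤ` to `g`. -/
def wordEval {Γ : Type*} [Group Γ] (g : Γ) : Monoid.Coprod Γ (Multiplicative ℤ) →* Γ :=
  Monoid.Coprod.lift (MonoidHom.id Γ) (zpowersHom Γ g)

/-- `Γ` is mixed identity free: no non-trivial word in `Γ ∗ ℤ` vanishes identically on `Γ`. -/
def IsMIF (Γ : Type*) [Group Γ] : Prop :=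
  ∀ w : Monoid.Coprod Γ (Multiplicative ℤ), (∀ g : Γ, wordEval g w = 1) → w = 1

/-- `Γ` is torsion-free: only the identity has finite order. -/
def IsTorsionFreeGroup (Γ : Type*) [Group Γ] : Prop :=
  ∀ γ : Γ, IsOfFinOrder γ → γ = 1

/-! Properties of actions -/

section Actions

variable (Γ : Type*) [Group Γ] {X : Type*} [MeasurableSpace X] [MulAction Γ X] (μ : Measure X)

/-- The action is faithful as an action on the measure space: only the identity of `Γ` acts
trivially almost everywhere. -/
def IsFaithfulAction : Prop :=
  ∀ γ : Γ, (∀ᵐ x ∂μ, γ • x = x) → γ = 1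

/-- The action is essentially free: fixed-point sets of non-trivial elements are null. -/
def IsEssentiallyFree : Prop :=
  ∀ γ : Γ, γ ≠ 1 → ∀ᵐ x ∂μ, γ • x ≠ x

/-- The action is weakly mixing: for every finite collection of measurable sets and every `ε > 0`
there is one group element that makes all pairs of the collection `ε`-independent. -/
def IsWeaklyMixing : Prop :=
  ∀ 𝒜 : Set (Set X), 𝒜.Finite → (∀ A ∈ 𝒜, MeasurableSet A) → ∀ ε : ℝ, 0 < ε →
    ∃ γ : Γ, ∀ A ∈ 𝒜, ∀ B ∈ 𝒜, |μ.real ((γ • A) ∩ B) - μ.real A * μ.real B| < ε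

/-- The action is (strongly) mixing: `μ(γA ∩ B) → μ(A)μ(B)` as `γ` leaves finite subsets of `Γ`. -/
def IsMixing : Prop :=
  ∀ A B : Set X, MeasurableSet A → MeasurableSet B → ∀ ε : ℝ, 0 < ε →
    ∃ F : Finset Γ, ∀ γ : Γ, γ ∉ F → |μ.real ((γ • A) ∩ B) - μ.real A * μ.real B| < ε

end Actions

/-! The full group -/

section FullGroup

variable (Γ : Type*) [Group Γ] {X : Type*} [MeasurableSpace X] [MulAction Γ X] (μ : Measure X)

/-- Measure preserving automorphisms of `X` that map almost every point into its `Γ`-orbit,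
before identifying automorphisms that agree almost everywhere. -/
def preFullGroup : Subgroup (Equiv.Perm X) where
  carrier := {T | MeasurePreserving (⇑T) μ μ ∧ MeasurePreserving (⇑T⁻¹) μ μ ∧
    ∀ᵐ x ∂μ, T x ∈ MulAction.orbit Γ x}
  one_mem' := ⟨MeasurePreserving.id μ, MeasurePreserving.id μ,
    Filter.Eventually.of_forall fun x => MulAction.mem_orbit_self x⟩
  mul_mem' := by
    rintro S T ⟨hS, hS', hSo⟩ ⟨hT, hT', hTo⟩
    refine ⟨hS.comp hT, ?_, ?_⟩
    · rw [mul_inv_rev]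
      exact hT'.comp hS'
    · filter_upwards [hTo, hT.quasiMeasurePreserving.ae hSo] with x h1 h2
      rw [← MulAction.orbit_eq_iff.mpr h1]
      exact h2
  inv_mem' := by
    rintro T ⟨hT, hT', hTo⟩
    refine ⟨hT', by rwa [inv_inv], ?_⟩
    filter_upwards [hT'.quasiMeasurePreserving.ae hTo] with x h1
    have h2 : T (T⁻¹ x) = x := T.apply_symm_apply x
    rw [h2] at h1
    exact MulAction.mem_orbit_symm.mp h1

/-- The automorphisms that are the identity almost everywhere. -/
def aeTrivial : Subgroup (preFullGroup Γ μ) where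
  carrier := {T | ∀ᵐ x ∂μ, T.1 x = x}
  one_mem' := by
    change ∀ᵐ x ∂μ, (1 : Equiv.Perm X) x = x
    exact Filter.Eventually.of_forall fun _ => rfl
  mul_mem' := by
    intro S T hS hT
    change ∀ᵐ x ∂μ, S.1 (T.1 x) = x
    filter_upwards [hS, hT] with x h1 h2
    rw [h2, h1]
  inv_mem' := by
    intro T hT
    change ∀ᵐ x ∂μ, T.1⁻¹ x = x
    filter_upwards [hT] with x h1
    rw [Equiv.Perm.inv_eq_iff_eq, h1]

instance aeTrivial_normal : (aeTrivial Γ μ).Normal where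
  conj_mem := by
    intro T hT S
    change ∀ᵐ x ∂μ, S.1 (T.1 (S.1⁻¹ x)) = x
    filter_upwards [S.2.2.1.quasiMeasurePreserving.ae hT] with x h1
    rw [h1]
    exact S.1.apply_symm_apply x

/-- The full group `[Γ ↷ (X, μ)]`: automorphisms in `preFullGroup`, modulo equality almost
everywhere. -/
def FullGroup : Type _ := preFullGroup Γ μ ⧸ aeTrivial Γ μ

instance : Group (FullGroup Γ μ) :=
  inferInstanceAs (Group (preFullGroup Γ μ ⧸ aeTrivial Γ μ))

/-- The class of an automorphism in the full group. -/
def FullGroup.mk : preFullGroup Γ μ →* FullGroup Γ μ := QuotientGroup.mk' (aeTrivial Γ μ)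

/-- The support `S(T) = {x | T x ≠ x}`. -/
def autSupport {X : Type*} (T : Equiv.Perm X) : Set X := {x | T x ≠ x}

variable {Γ μ}

/-- The length `ℓ(g) = μ(S(g))` on the full group; `S(g)` is well defined up to null sets. -/
def suppMeasure : FullGroup Γ μ → ℝ :=
  Quotient.lift (fun T : preFullGroup Γ μ => μ.real (autSupport T.1)) (by
    intro S T h
    have h' : ∀ᵐ x ∂μ, S.1⁻¹ (T.1 x) = x := QuotientGroup.leftRel_apply.mp h
    apply measureReal_congr
    filter_upwards [h'] with x hx
    rw [Equiv.Perm.inv_eq_iff_eq] at hx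
    change (S.1 x ≠ x) = (T.1 x ≠ x)
    rw [hx])

theorem suppMeasure_mk (T : preFullGroup Γ μ) :
    suppMeasure (FullGroup.mk Γ μ T) = μ.real (autSupport T.1) := rfl

theorem FullGroup.mk_surjective : Function.Surjective (FullGroup.mk Γ μ) :=
  QuotientGroup.mk'_surjective _

theorem FullGroup.mk_eq_one_iff (T : preFullGroup Γ μ) :
    FullGroup.mk Γ μ T = 1 ↔ ∀ᵐ x ∂μ, T.1 x = x :=
  QuotientGroup.eq_one_iff T

theorem suppMeasure_one : suppMeasure (1 : FullGroup Γ μ) = 0 := by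
  rw [← map_one (FullGroup.mk Γ μ), suppMeasure_mk]
  simp [autSupport]

theorem suppMeasure_inv (g : FullGroup Γ μ) : suppMeasure g⁻¹ = suppMeasure g := by
  obtain ⟨T, rfl⟩ := FullGroup.mk_surjective g
  rw [← map_inv, suppMeasure_mk, suppMeasure_mk]
  congr 1
  ext x
  change T.1⁻¹ x ≠ x ↔ T.1 x ≠ x
  rw [ne_eq, ne_eq, Equiv.Perm.inv_eq_iff_eq, eq_comm]

variable [IsProbabilityMeasure μ]

theorem suppMeasure_mul_le (g h : FullGroup Γ μ) :
    suppMeasure (g * h) ≤ suppMeasure g + suppMeasure h := by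
  obtain ⟨S, rfl⟩ := FullGroup.mk_surjective g
  obtain ⟨T, rfl⟩ := FullGroup.mk_surjective h
  rw [← map_mul, suppMeasure_mk, suppMeasure_mk, suppMeasure_mk]
  refine (measureReal_mono ?_).trans (measureReal_union_le _ _)
  intro x hx
  by_contra hc
  simp only [autSupport, Set.mem_union, Set.mem_ofPred_eq, not_or, not_not] at hc
  apply hx
  change S.1 (T.1 x) = x
  rw [hc.2, hc.1]

theorem eq_one_of_suppMeasure_eq_zero (g : FullGroup Γ μ) (hg : suppMeasure g = 0) : g = 1 := by
  obtain ⟨T, rfl⟩ := FullGroup.mk_surjective g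
  rw [suppMeasure_mk, measureReal_eq_zero_iff] at hg
  rw [FullGroup.mk_eq_one_iff]
  exact hg

/-- The metric `d(g, h) = ℓ(g h⁻¹)` on the full group. -/
instance : MetricSpace (FullGroup Γ μ) where
  dist g h := suppMeasure (g * h⁻¹)
  dist_self g := by
    rw [mul_inv_cancel, suppMeasure_one]
  dist_comm g h := by
    rw [← suppMeasure_inv, mul_inv_rev, inv_inv]
  dist_triangle g h k := by
    have := suppMeasure_mul_le (g * h⁻¹) (h * k⁻¹)
    rwa [mul_assoc, inv_mul_cancel_left] at this
  eq_of_dist_eq_zero {g h} hgh := mul_inv_eq_one.mp (eq_one_of_suppMeasure_eq_zero _ hgh)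

/-- A subgroup of the full group is discrete if the topology that it inherits from the metric `d`
is the discrete one. -/
def IsDiscreteSubgroup (Λ : Subgroup (FullGroup Γ μ)) : Prop := DiscreteTopology Λ

end FullGroup

section Embedding

variable (Γ : Type*) [Group Γ] {X : Type*} [MeasurableSpace X] [MulAction Γ X] (μ : Measure X)
  [MeasurableConstSMul Γ X] [SMulInvariantMeasure Γ X μ]

/-- The homomorphism that sends `γ` to the class of `x ↦ γ • x`. -/
def toFullGroup : Γ →* FullGroup Γ μ :=
  (FullGroup.mk Γ μ).comp
    ((MulAction.toPermHom Γ X).codRestrict (preFullGroup Γ μ) (by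
      intro γ
      refine ⟨measurePreserving_smul γ μ, ?_,
        Filter.Eventually.of_forall fun x => MulAction.mem_orbit x γ⟩
      rw [← map_inv]
      exact measurePreserving_smul γ⁻¹ μ))

/-- The copy of `Γ` inside the full group. -/
def groupInFullGroup : Subgroup (FullGroup Γ μ) := (toFullGroup Γ μ).range

end Embedding

end

/-! Write ℓ(g) = μ(S(g)). The commutator of g with h is supported on three sets of measure μ(S(g) ∩
S(h)). If h = γgγ⁻¹ with γ making S(g) almost independent of its translate, its length is thus at
most about 3ℓ(g)². Let Λ be a discrete subgroup containing Γ, and let c > 0 be the infimum of ℓ on Λ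
∖ {1}. If c < 1/3, some k ≠ 1 in Λ has 3ℓ(k)² < c, and a nontrivial commutator of k with a suitable
γkγ⁻¹ contradicts the choice of c. So nontrivial elements of Λ have length at least 1/3. This gives
the first claim. The bound is uniform in Λ, so it survives unions of chains, and Zorn's lemma gives
the second.

The work is in finding γ for which k and γkγ⁻¹ do not commute (`IsMixing.exists_not_commute`,
`IsMIF.exists_not_commute`). Let k act as a ≠ 1 on a set A of positive measure. In the mixing case
take γ = aⁿ: commutation would make S(k) invariant under a, hence null or conull. In the MIF case
commutation at a point of A ∩ γA becomes, by freeness, one of finitely many equations in γ. Mixed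
identity freeness makes all of them fail at some g, and syndeticity (`IsWeaklyMixing.syndetic`)
corrects g to an almost independent γ = ug with u from a finite set fixed in advance. -/

noncomputable section

open Monoid

/-! ### Reduced words and commutators in free products. -/

section FreeProducts

variable {ι : Type*} {G : ι → Type*} [∀ i, Group (G i)]

theorem neWord_prod_ne_one {i j : ι} (w : CoprodI.NeWord G i j) : w.prod ≠ 1 := by
  classical
  intro h
  have h2 : w.toWord = CoprodI.Word.empty := by
    apply CoprodI.Word.equiv.symm.injective
    change w.toWord.prod = CoprodI.Word.prod CoprodI.Word.empty
    rw [CoprodI.Word.prod_empty]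
    exact h
  exact w.toList_ne_nil (congrArg CoprodI.Word.toList h2)

theorem exists_neWord_of_ne_one {x : CoprodI G} (hx : x ≠ 1) :
    ∃ (i j : ι) (w : CoprodI.NeWord G i j), w.prod = x := by
  classical
  obtain ⟨i, j, w, hw⟩ := CoprodI.NeWord.of_word (CoprodI.Word.equiv x) (by
    intro h
    apply hx
    rw [← CoprodI.Word.equiv.symm_apply_apply x, h]
    exact CoprodI.Word.prod_empty)
  refine ⟨i, j, w, ?_⟩
  change w.toWord.prod = x
  rw [hw]
  exact CoprodI.Word.equiv.symm_apply_apply x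

/-- Every nontrivial element of a free product is conjugate to a reduced word that starts and ends
in a prescribed factor, provided that this factor has at least three elements. -/
theorem exists_conj_neWord {k : ι} (hk : ∀ y : G k, ∃ g : G k, g ≠ 1 ∧ g * y ≠ 1)
    {x : CoprodI G} (hx : x ≠ 1) :
    ∃ (c : CoprodI G) (w : CoprodI.NeWord G k k), w.prod = c * x * c⁻¹ := by
  have key : ∀ {j : ι} (w : CoprodI.NeWord G k j), k ≠ j →
      ∃ (c : CoprodI G) (v : CoprodI.NeWord G k k), v.prod = c * w.prod * c⁻¹ := by
    intro j w hj
    obtain ⟨g, hg, hgw⟩ := hk w.head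
    exact ⟨CoprodI.of g, .append (w.mulHead g hgw) hj.symm (.singleton g⁻¹ (inv_ne_one.mpr hg)),
      by simp⟩
  obtain ⟨i, j, w, rfl⟩ := exists_neWord_of_ne_one hx
  by_cases hi : k = i
  · subst hi
    by_cases hj : k = j
    · subst hj
      exact ⟨1, w, by simp⟩
    · exact key w hj
  · by_cases hj : k = j
    · subst hj
      obtain ⟨c, v, hv⟩ := key w.inv hi
      exact ⟨c, v.inv, by simp [hv, mul_assoc]⟩
    · obtain ⟨g, hg, -⟩ := hk 1
      exact ⟨CoprodI.of g, .append (.singleton g hg) hi (.append w (Ne.symm hj)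
        (.singleton g⁻¹ (inv_ne_one.mpr hg))), by simp [mul_assoc]⟩

/-- Two nontrivial elements of a free product have noncommuting conjugates. -/
theorem exists_conj_commutator_ne_one {k l : ι} (hkl : k ≠ l)
    (hk : ∀ y : G k, ∃ g : G k, g ≠ 1 ∧ g * y ≠ 1) [Nontrivial (G l)]
    {x y : CoprodI G} (hx : x ≠ 1) (hy : y ≠ 1) :
    ∃ c d : CoprodI G, c * x * c⁻¹ * (d * y * d⁻¹) * (c * x * c⁻¹)⁻¹ * (d * y * d⁻¹)⁻¹ ≠ 1 := by
  obtain ⟨c, v, hv⟩ := exists_conj_neWord hk hx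
  obtain ⟨d, w, hw⟩ := exists_conj_neWord hk hy
  obtain ⟨s, hs⟩ := exists_ne (1 : G l)
  -- With one word starting and ending in `k` and the other in `l`, their commutator is reduced as
  -- written.
  let w' : CoprodI.NeWord G l l :=
    .append (.singleton s hs) hkl.symm (.append w hkl (.singleton s⁻¹ (inv_ne_one.mpr hs)))
  have hw' : w'.prod = CoprodI.of s * d * y * (CoprodI.of s * d)⁻¹ := by
    simp [w', hw, mul_assoc]
  refine ⟨c, CoprodI.of s * d, ?_⟩
  have := neWord_prod_ne_one
    (CoprodI.NeWord.append v hkl (.append w' hkl.symm (.append v.inv hkl w'.inv)))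
  simpa [hv, hw', mul_assoc] using this

/-- A finite family of nontrivial elements of a free product can be combined into one nontrivial
element that dies in every quotient where a member of the family dies. -/
theorem exists_ne_one_forall_map_ne_one {k l : ι} (hkl : k ≠ l)
    (hk : ∀ y : G k, ∃ g : G k, g ≠ 1 ∧ g * y ≠ 1) [Nontrivial (G l)] {H : Type*} [Group H]
    {κ : Type*} (s : Finset κ) (x : κ → CoprodI G) (hx : ∀ i ∈ s, x i ≠ 1) :
    ∃ w : CoprodI G, w ≠ 1 ∧ ∀ f : CoprodI G →* H, f w ≠ 1 → ∀ i ∈ s, f (x i) ≠ 1 := by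
  classical
  induction s using Finset.induction_on with
  | empty =>
    obtain ⟨g, hg⟩ := exists_ne (1 : G l)
    exact ⟨CoprodI.of g, by simpa using neWord_prod_ne_one (CoprodI.NeWord.singleton g hg),
      by simp⟩
  | insert a s ha ih =>
    obtain ⟨w, hw, hws⟩ := ih fun i hi => hx i (Finset.mem_insert_of_mem hi)
    -- A homomorphism that kills either entry kills the commutator of the conjugates.
    obtain ⟨c, d, hcd⟩ := exists_conj_commutator_ne_one hkl hk
      (hx a (Finset.mem_insert_self a s)) hw
    refine ⟨_, hcd, fun f hf i hi => ?_⟩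
    rcases Finset.mem_insert.mp hi with rfl | hi
    · intro h
      exact hf (by simp [h])
    · refine hws f (fun h => hf (by simp [h])) i hi

end FreeProducts

/-! ### Mixed identities and their simultaneous failure. -/

section MixedIdentities

universe u

variable (Γ : Type u) [Group Γ]

/-- The two factors of `Γ ∗ ℤ` as a family. -/
def mixedFactor : Bool → Type u
  | true => Γ
  | false => ULift.{u} (Multiplicative ℤ)

instance : ∀ b, Group (mixedFactor Γ b)
  | true => inferInstanceAs (Group Γ)
  | false => inferInstanceAs (Group (ULift.{u} (Multiplicative ℤ)))

variable {Γ}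

/-- A constant in `Γ ∗ ℤ`. -/
def mixedConst : Γ →* CoprodI (mixedFactor Γ) :=
  CoprodI.of (M := mixedFactor Γ) (i := true)

/-- The generator of `ℤ` in the second factor. -/
def mixedGen (Γ : Type u) [Group Γ] : mixedFactor Γ false :=
  (ULift.up (Multiplicative.ofAdd 1) : ULift.{u} (Multiplicative ℤ))

theorem mixedGen_ne_one : mixedGen Γ ≠ 1 := by
  intro h
  have : Multiplicative.ofAdd (1 : ℤ) = 1 := congrArg ULift.down h
  simp at this

/-- The variable of `Γ ∗ ℤ`. -/
def mixedVar (Γ : Type u) [Group Γ] : CoprodI (mixedFactor Γ) :=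
  CoprodI.of (mixedGen Γ)

/-- Evaluation of words at a group element. -/
def mixedEval (g : Γ) : CoprodI (mixedFactor Γ) →* Γ :=
  CoprodI.lift fun
    | true => MonoidHom.id Γ
    | false => (zpowersHom Γ g).comp (MulEquiv.ulift (α := Multiplicative ℤ)).toMonoidHom

@[simp]
theorem mixedEval_const (g γ : Γ) : mixedEval g (mixedConst γ) = γ := by
  simp only [mixedEval, mixedConst]
  rfl

@[simp]
theorem mixedEval_var (g : Γ) : mixedEval g (mixedVar Γ) = g := by
  simp only [mixedEval, mixedVar, CoprodI.lift_of]
  change g ^ (1 : ℤ) = g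
  exact zpow_one g

/-- The comparison of the two models of `Γ ∗ ℤ`. -/
def mixedToCoprod : CoprodI (mixedFactor Γ) →* Coprod Γ (Multiplicative ℤ) :=
  CoprodI.lift fun
    | true => Coprod.inl
    | false => Coprod.inr.comp (MulEquiv.ulift (α := Multiplicative ℤ)).toMonoidHom

/-- Normal forms live in the `CoprodI` model and `IsMIF` speaks of `Coprod`; injectivity carries
nontrivial words across. -/
theorem mixedToCoprod_injective : Function.Injective (mixedToCoprod (Γ := Γ)) := by
  let f : Coprod Γ (Multiplicative ℤ) →* CoprodI (mixedFactor Γ) :=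
    Coprod.lift (CoprodI.of (M := mixedFactor Γ) (i := true))
      ((CoprodI.of (M := mixedFactor Γ) (i := false)).comp
        (MulEquiv.ulift (α := Multiplicative ℤ)).symm.toMonoidHom)
  have hf : f.comp mixedToCoprod = MonoidHom.id _ := by
    refine CoprodI.ext_hom _ _ fun b => ?_
    ext x
    cases b
    · simp only [f, mixedToCoprod, MonoidHom.comp_apply, CoprodI.lift_of]
      exact Coprod.lift_apply_inr _ _ _
    · simp only [f, mixedToCoprod, MonoidHom.comp_apply, CoprodI.lift_of]
      exact Coprod.lift_apply_inl _ _ _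
  exact Function.LeftInverse.injective (g := f) fun x => DFunLike.congr_fun hf x

theorem wordEval_mixedToCoprod (g : Γ) (w : CoprodI (mixedFactor Γ)) :
    wordEval g (mixedToCoprod w) = mixedEval g w := by
  have : (wordEval g).comp mixedToCoprod = mixedEval g := by
    refine CoprodI.ext_hom _ _ fun b => ?_
    ext x
    cases b
    · simp only [mixedEval, mixedToCoprod, MonoidHom.comp_apply, CoprodI.lift_of]
      exact Coprod.lift_apply_inr _ _ _
    · simp only [mixedEval, mixedToCoprod, MonoidHom.comp_apply, CoprodI.lift_of]
      exact Coprod.lift_apply_inl _ _ _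
  exact DFunLike.congr_fun this w

/-- In a nontrivial mixed identity free group, finitely many nontrivial words are simultaneously
nonzero at some point. -/
theorem IsMIF.exists_forall_mixedEval_ne_one [Nontrivial Γ] (hΓ : IsMIF Γ) {κ : Type*}
    (s : Finset κ) (x : κ → CoprodI (mixedFactor Γ)) (hx : ∀ i ∈ s, x i ≠ 1) :
    ∃ g : Γ, ∀ i ∈ s, mixedEval g (x i) ≠ 1 := by
  have hz : ∀ y : mixedFactor Γ false, ∃ g : mixedFactor Γ false, g ≠ 1 ∧ g * y ≠ 1 := by
    intro y
    by_cases h : mixedGen Γ * y = 1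
    · refine ⟨mixedGen Γ * mixedGen Γ, fun h2 => ?_, fun h2 => ?_⟩
      · have : Multiplicative.ofAdd (1 : ℤ) * Multiplicative.ofAdd (1 : ℤ) = 1 :=
          congrArg ULift.down h2
        rw [← ofAdd_add, ofAdd_eq_one] at this
        norm_num at this
      · rw [mul_assoc, h, mul_one] at h2
        exact mixedGen_ne_one h2
    · exact ⟨mixedGen Γ, mixedGen_ne_one, h⟩
  have : Nontrivial (mixedFactor Γ true) := inferInstanceAs (Nontrivial Γ)
  obtain ⟨w, hw, hws⟩ := exists_ne_one_forall_map_ne_one (H := Γ) (k := false) (l := true)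
    (by simp) hz s x hx
  have : ∃ g : Γ, mixedEval g w ≠ 1 := by
    by_contra! hc
    refine hw (mixedToCoprod_injective ?_)
    rw [map_one]
    exact hΓ _ fun g => (wordEval_mixedToCoprod g w).trans (hc g)
  obtain ⟨g, hg⟩ := this
  exact ⟨g, hws _ hg⟩

/-- The word `b t a t⁻¹ c t d t⁻¹`. -/
def doubleConjWord (a c b d : Γ) : CoprodI (mixedFactor Γ) :=
  mixedConst b * (mixedVar Γ * mixedConst a * (mixedVar Γ)⁻¹ * mixedConst c *
    (mixedVar Γ * mixedConst d * (mixedVar Γ)⁻¹))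

theorem mixedEval_doubleConjWord (g a c b d : Γ) :
    mixedEval g (doubleConjWord a c b d) = b * (g * a * g⁻¹ * c * (g * d * g⁻¹)) := by
  simp [doubleConjWord]

/-- The core `t a t⁻¹ c` is reduced. If `d` or `b` is trivial, the word only loses outer letters. -/
theorem doubleConjWord_ne_one {a c : Γ} (ha : a ≠ 1) (hc : c ≠ 1) (b d : Γ) :
    doubleConjWord a c b d ≠ 1 := by
  let t : CoprodI.NeWord (mixedFactor Γ) false false := .singleton (mixedGen Γ) mixedGen_ne_one
  let t' : CoprodI.NeWord (mixedFactor Γ) false false :=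
    .singleton (mixedGen Γ)⁻¹ (inv_ne_one.mpr mixedGen_ne_one)
  have ht : t.prod = mixedVar Γ := by simp [t, mixedVar]
  have ht' : t'.prod = (mixedVar Γ)⁻¹ := by simp [t', mixedVar]
  have hft : false ≠ true := by simp
  let κ : ∀ γ : Γ, γ ≠ 1 → CoprodI.NeWord (mixedFactor Γ) true true := fun γ hγ =>
    .singleton (M := mixedFactor Γ) (i := true) γ hγ
  have hκ : ∀ γ hγ, (κ γ hγ).prod = mixedConst γ := fun γ hγ =>
    CoprodI.NeWord.prod_singleton (M := mixedFactor Γ) (i := true) γ hγ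
  let u : CoprodI.NeWord (mixedFactor Γ) false true :=
    .append (.append (.append t hft (κ a ha)) hft.symm t') hft (κ c hc)
  have hu : u.prod = mixedVar Γ * mixedConst a * (mixedVar Γ)⁻¹ * mixedConst c := by
    simp [u, ht, ht', hκ]
  have key : ∃ (j : Bool) (v : CoprodI.NeWord (mixedFactor Γ) false j),
      v.prod = mixedVar Γ * mixedConst a * (mixedVar Γ)⁻¹ * mixedConst c *
        (mixedVar Γ * mixedConst d * (mixedVar Γ)⁻¹) := by
    by_cases hd : d = 1
    · exact ⟨_, u, by simp [hu, hd]⟩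
    · exact ⟨_, .append u hft.symm (.append (.append t hft (κ d hd)) hft.symm t'),
        by simp [hu, ht, ht', hκ]⟩
  obtain ⟨j, v, hv⟩ := key
  rw [doubleConjWord, ← hv]
  by_cases hb : b = 1
  · subst hb
    simpa using neWord_prod_ne_one v
  · simpa [hκ] using neWord_prod_ne_one (CoprodI.NeWord.append (κ b hb) hft.symm v)

end MixedIdentities

end

noncomputable section

/-! ### A Bessel inequality and covariances. -/

section AlmostOrthogonal

open scoped RealInnerProductSpace

/-- A Bessel inequality for almost orthogonal families. -/
theorem sum_inner_sq_le_of_almost_orthogonal {E : Type*} [NormedAddCommGroup E]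
    [InnerProductSpace ℝ E] {κ : Type*} (s : Finset κ) (e : κ → E) {x : E} {η : ℝ} (hη : 0 ≤ η)
    (hx : ‖x‖ ≤ 1) (he : ∀ i ∈ s, ‖e i‖ ≤ 1)
    (hee : ∀ i ∈ s, ∀ j ∈ s, i ≠ j → |⟪e i, e j⟫| ≤ η) :
    ∑ i ∈ s, ⟪x, e i⟫ ^ 2 ≤ 1 + η * s.card := by
  classical
  set c : κ → ℝ := fun i => ⟪x, e i⟫ with hc
  set Q := ∑ i ∈ s, c i ^ 2 with hQ
  set v := ∑ i ∈ s, c i • e i with hv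
  have hxv : ⟪x, v⟫ = Q := by
    rw [hv, inner_sum]
    exact Finset.sum_congr rfl fun i _ => by rw [real_inner_smul_right, hc]; ring
  have hvv : ⟪v, v⟫ ≤ Q + η * (s.card * Q) := by
    have h1 : ⟪v, v⟫ = ∑ i ∈ s, ∑ j ∈ s, c i * c j * ⟪e i, e j⟫ := by
      rw [hv, sum_inner]
      refine Finset.sum_congr rfl fun i _ => ?_
      rw [inner_sum]
      refine Finset.sum_congr rfl fun j _ => ?_
      rw [real_inner_smul_left, real_inner_smul_right]
      ring
    have h2 : ∀ i ∈ s, ∀ j ∈ s, c i * c j * ⟪e i, e j⟫ ≤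
        (if i = j then c i ^ 2 else 0) + η * (|c i| * |c j|) := by
      intro i hi j hj
      by_cases hij : i = j
      · subst hij
        rw [if_pos rfl, real_inner_self_eq_norm_sq]
        have h3 : ‖e i‖ ^ 2 ≤ 1 := pow_le_one₀ (norm_nonneg _) (he i hi)
        have h4 : 0 ≤ η * (|c i| * |c i|) := by positivity
        nlinarith [mul_self_nonneg (c i)]
      · rw [if_neg hij, zero_add]
        calc c i * c j * ⟪e i, e j⟫ ≤ |c i * c j * ⟪e i, e j⟫| := le_abs_self _
          _ = |c i| * |c j| * |⟪e i, e j⟫| := by rw [abs_mul, abs_mul]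
          _ ≤ |c i| * |c j| * η := by gcongr; exact hee i hi j hj hij
          _ = η * (|c i| * |c j|) := mul_comm _ _
    have h3 : (∑ i ∈ s, |c i|) ^ 2 ≤ s.card * Q := by
      simpa [hQ] using sq_sum_le_card_mul_sum_sq (s := s) (f := fun i => |c i|)
    calc ⟪v, v⟫ ≤ ∑ i ∈ s, ∑ j ∈ s, ((if i = j then c i ^ 2 else 0) + η * (|c i| * |c j|)) := by
          rw [h1]
          exact Finset.sum_le_sum fun i hi => Finset.sum_le_sum fun j hj => h2 i hi j hj
      _ = Q + η * (∑ i ∈ s, |c i|) ^ 2 := by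
          simp only [Finset.sum_add_distrib, Finset.sum_ite_eq, ← Finset.mul_sum]
          rw [sq, Finset.sum_mul_sum]
          simp [hQ, Finset.mul_sum]
      _ ≤ Q + η * (s.card * Q) := by gcongr
  have hQ0 : 0 ≤ Q := Finset.sum_nonneg fun i _ => sq_nonneg _
  -- Cauchy–Schwarz applied to `Q = ⟪x, v⟫`; with `hvv` it allows division by `Q`.
  have hcs : Q ^ 2 ≤ ⟪v, v⟫ := by
    have h1 : |⟪x, v⟫| ≤ ‖x‖ * ‖v‖ := abs_real_inner_le_norm x v
    rw [hxv, abs_of_nonneg hQ0] at h1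
    have h2 : Q ≤ ‖v‖ := h1.trans (mul_le_of_le_one_left (norm_nonneg _) hx)
    rw [real_inner_self_eq_norm_sq]
    gcongr
  rcases hQ0.eq_or_lt with h0 | h0
  · rw [← h0]
    positivity
  · have : Q * Q ≤ Q * (1 + η * s.card) := by nlinarith
    exact le_of_mul_le_mul_left this h0

variable {X : Type*} [MeasurableSpace X] {μ : Measure X} [IsProbabilityMeasure μ]

/-- Pairwise almost independent sets of equal measure are almost all almost independent of any
given set. -/
theorem sum_covariance_sq_le {κ : Type*} (s : Finset κ) {D : Set X} (hD : MeasurableSet D)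
    (B : κ → Set X) (hB : ∀ i, MeasurableSet (B i)) {η : ℝ} (hη : 0 ≤ η)
    (hBB : ∀ i ∈ s, ∀ j ∈ s, i ≠ j →
      |μ.real (B i ∩ B j) - μ.real (B i) * μ.real (B j)| ≤ η) :
    ∑ i ∈ s, (μ.real (D ∩ B i) - μ.real D * μ.real (B i)) ^ 2 ≤ 1 + η * s.card := by
  let v : ∀ C : Set X, MeasurableSet C → Lp ℝ 2 μ := fun C hC =>
    indicatorConstLp 2 hC (measure_ne_top μ C) (1 : ℝ)
  have hvv : ∀ C hC C' hC', ⟪v C hC, v C' hC'⟫ = μ.real (C ∩ C') := fun C hC C' hC' =>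
    L2.real_inner_indicatorConstLp_one_indicatorConstLp_one hC hC'
  -- Centred indicators, whose inner products are covariances.
  let e : κ → Lp ℝ 2 μ := fun i => v (B i) (hB i) - μ.real (B i) • v Set.univ .univ
  have hve : ∀ C hC i, ⟪v C hC, e i⟫ = μ.real (C ∩ B i) - μ.real C * μ.real (B i) := by
    intro C hC i
    simp only [e, inner_sub_right, real_inner_smul_right, hvv, Set.inter_univ]
    ring
  have hee : ∀ i j, ⟪e i, e j⟫ = μ.real (B i ∩ B j) - μ.real (B i) * μ.real (B j) := by
    intro i j
    have : ⟪e i, e j⟫ = ⟪v (B i) (hB i), e j⟫ - μ.real (B i) * ⟪v Set.univ .univ, e j⟫ := by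
      conv_lhs => rw [show e i = v (B i) (hB i) - μ.real (B i) • v Set.univ .univ from rfl]
      rw [inner_sub_left, real_inner_smul_left]
    rw [this, hve, hve]
    simp
  have norm_le : ∀ w : Lp ℝ 2 μ, ⟪w, w⟫ ≤ 1 → ‖w‖ ≤ 1 := by
    intro w hw
    rw [real_inner_self_eq_norm_sq] at hw
    exact (sq_le_one_iff₀ (norm_nonneg _)).mp hw
  have := sum_inner_sq_le_of_almost_orthogonal s e (x := v D hD) hη
    (norm_le _ (by rw [hvv]; exact measureReal_le_one))
    (fun i _ => norm_le _ (by
      rw [hee, Set.inter_self]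
      nlinarith [measureReal_le_one (μ := μ) (s := B i), mul_self_nonneg (μ.real (B i))]))
    (fun i hi j hj hij => by rw [hee]; exact hBB i hi j hj hij)
  simpa only [hve] using this

end AlmostOrthogonal

/-! ### Syndeticity of almost independence. -/

section WeakMixing

variable {Γ : Type*} [Group Γ] {X : Type*} [MeasurableSpace X] [MulAction Γ X] {μ : Measure X}
  [SMulInvariantMeasure Γ X μ]

theorem measureReal_smul_set (γ : Γ) (A : Set X) : μ.real (γ • A) = μ.real A := by
  simp [Measure.real]

variable [MeasurableConstSMul Γ X]

/-- Greedy choice: weak mixing is applied to the sets together with all translates chosen so far. -/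
theorem IsWeaklyMixing.exists_almost_independent (h : IsWeaklyMixing Γ μ) {κ : Type*} [Finite κ]
    (B : κ → Set X) (hB : ∀ k, MeasurableSet (B k)) {η : ℝ} (hη : 0 < η) (n : ℕ) :
    ∃ u : ℕ → Γ, ∀ i < n, ∀ j < i, ∀ k,
      |μ.real (u i • B k ∩ u j • B k) - μ.real (B k) * μ.real (B k)| < η := by
  induction n with
  | zero => exact ⟨fun _ => 1, by simp⟩
  | succ n ih =>
    obtain ⟨u, hu⟩ := ih
    obtain ⟨γ, hγ⟩ := h (Set.range B ∪ Set.range fun p : Fin n × κ => u p.1 • B p.2)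
      ((Set.finite_range _).union (Set.finite_range _)) (by
        rintro _ (⟨k, rfl⟩ | ⟨p, rfl⟩)
        · exact hB k
        · exact (hB p.2).const_smul _) η hη
    refine ⟨Function.update u n γ, fun i hi j hj k => ?_⟩
    have hjn : j < n := by omega
    rw [Function.update_of_ne hjn.ne]
    rcases (Nat.lt_succ_iff.mp hi).eq_or_lt with rfl | hi'
    · rw [Function.update_self]
      have := hγ (B k) (.inl ⟨k, rfl⟩) (u j • B k) (.inr ⟨(⟨j, hjn⟩, k), rfl⟩)
      rwa [measureReal_smul_set] at this
    · rw [Function.update_of_ne hi'.ne]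
      exact hu i hi' j hj k

variable [IsProbabilityMeasure μ]

/-- For a weakly mixing action, the set of group elements that make a given finite family of sets
almost independent of their translates is syndetic. -/
theorem IsWeaklyMixing.syndetic (h : IsWeaklyMixing Γ μ) {κ : Type*} [Fintype κ]
    (B : κ → Set X) (hB : ∀ k, MeasurableSet (B k)) {δ : ℝ} (hδ : 0 < δ) :
    ∃ U : Finset Γ, ∀ γ : Γ, ∃ u ∈ U, ∀ k,
      |μ.real ((u * γ) • B k ∩ B k) - μ.real (B k) * μ.real (B k)| < δ := by
  classical
  -- If every `(u i)⁻¹` fails for `γ`, each `i` contributes at least `δ²` to the sum of squared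
  -- covariances. Bessel with `η = 1 / n` bounds the sum over `i` by 2 for each `k`, so `n δ² ≤ 2
  -- |κ|`.
  obtain ⟨n, hn⟩ := exists_nat_gt (2 * Fintype.card κ / δ ^ 2)
  have hn0 : (0 : ℝ) < n := lt_of_le_of_lt (by positivity) hn
  have hη : (0 : ℝ) < 1 / n := by positivity
  obtain ⟨u, hu⟩ := h.exists_almost_independent B hB hη n
  refine ⟨(Finset.range n).image fun i => (u i)⁻¹, fun γ => ?_⟩
  by_contra! hc
  have hc' : ∀ i ∈ Finset.range n,
      δ ^ 2 ≤ ∑ k, (μ.real (γ • B k ∩ u i • B k) - μ.real (γ • B k) * μ.real (u i • B k)) ^ 2 := by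
    intro i hi
    obtain ⟨k, hk⟩ := hc _ (Finset.mem_image_of_mem _ hi)
    have heq : μ.real (((u i)⁻¹ * γ) • B k ∩ B k) = μ.real (γ • B k ∩ u i • B k) := by
      rw [← measureReal_smul_set (u i), Set.smul_set_inter, smul_smul, mul_inv_cancel_left]
    rw [heq] at hk
    calc δ ^ 2 ≤ |μ.real (γ • B k ∩ u i • B k) - μ.real (B k) * μ.real (B k)| ^ 2 := by gcongr
      _ = (μ.real (γ • B k ∩ u i • B k) - μ.real (γ • B k) * μ.real (u i • B k)) ^ 2 := by
        rw [sq_abs, measureReal_smul_set, measureReal_smul_set]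
      _ ≤ _ := Finset.single_le_sum (f := fun k =>
          (μ.real (γ • B k ∩ u i • B k) - μ.real (γ • B k) * μ.real (u i • B k)) ^ 2)
          (fun _ _ => sq_nonneg _) (Finset.mem_univ k)
  have h1 := Finset.sum_le_sum hc'
  rw [Finset.sum_comm] at h1
  have h2 : ∀ k ∈ (Finset.univ : Finset κ), ∑ i ∈ Finset.range n,
      (μ.real (γ • B k ∩ u i • B k) - μ.real (γ • B k) * μ.real (u i • B k)) ^ 2 ≤ 2 := by
    intro k _
    refine (sum_covariance_sq_le (Finset.range n) ((hB k).const_smul γ) (fun i => u i • B k)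
      (fun i => (hB k).const_smul _) hη.le fun i hi j hj hij => ?_).trans ?_
    · rw [measureReal_smul_set, measureReal_smul_set]
      rcases lt_or_gt_of_ne hij with hlt | hlt
      · rw [Set.inter_comm]
        exact (hu j (Finset.mem_range.mp hj) i hlt k).le
      · exact (hu i (Finset.mem_range.mp hi) j hlt k).le
    · rw [Finset.card_range, one_div, inv_mul_cancel₀ hn0.ne']
      norm_num
  have h3 := h1.trans (Finset.sum_le_sum h2)
  simp only [Finset.sum_const, Finset.card_range, nsmul_eq_mul, Finset.card_univ] at h3
  rw [div_lt_iff₀ (by positivity)] at hn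
  linarith

end WeakMixing

end

noncomputable section

open Filter Topology

/-! ### Invariant sets in mixing actions. -/

section Mixing

variable {Γ : Type*} [Group Γ] {X : Type*} [MeasurableSpace X] [MulAction Γ X] {μ : Measure X}
  [MeasurableConstSMul Γ X] [SMulInvariantMeasure Γ X μ]

theorem exists_pow_notMem_of_not_isOfFinOrder {b : Γ} (hb : ¬ IsOfFinOrder b) (F : Finset Γ) :
    ∃ n : ℕ, b ^ n ∉ F := by
  by_contra! hc
  have hinj : Function.Injective fun n : ℕ => b ^ n :=
    injective_pow_iff_not_isOfFinOrder.mpr hb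
  exact (Set.infinite_range_of_injective hinj)
    (F.finite_toSet.subset (Set.range_subset_iff.mpr hc))

/-- In a mixing action, a set that is invariant under an element of infinite order is null or
conull. -/
theorem IsMixing.measureReal_eq_mul_self (h : IsMixing Γ μ) {b : Γ} (hb : ¬ IsOfFinOrder b)
    {B : Set X} (hB : MeasurableSet B) (hinv : ∀ᵐ x ∂μ, b • x ∈ B ↔ x ∈ B) :
    μ.real B = μ.real B * μ.real B := by
  have hpow : ∀ n : ℕ, ∀ᵐ x ∂μ, b ^ n • x ∈ B ↔ x ∈ B := by
    intro n
    induction n with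
    | zero => simp
    | succ n ih =>
      filter_upwards [hinv, (measurePreserving_smul b μ).quasiMeasurePreserving.ae ih]
        with x h1 h2
      rw [pow_succ, mul_smul, h2, h1]
  have hb' : ¬ IsOfFinOrder b⁻¹ := by rwa [isOfFinOrder_inv_iff]
  refine eq_of_forall_dist_le fun ε hε => ?_
  obtain ⟨F, hF⟩ := h B B hB hB ε hε
  obtain ⟨n, hn⟩ := exists_pow_notMem_of_not_isOfFinOrder hb' F
  have := hF _ hn
  have heq : μ.real (b⁻¹ ^ n • B ∩ B) = μ.real B := by
    apply measureReal_congr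
    filter_upwards [hpow n] with x hx
    change (x ∈ b⁻¹ ^ n • B ∩ B) = (x ∈ B)
    rw [Set.mem_inter_iff, Set.mem_smul_set_iff_inv_smul_mem, inv_pow, inv_inv, hx, and_self]
  rw [heq] at this
  exact this.le

end Mixing

/-! ### Supports and local behaviour of full group elements. -/

section Supports

variable {Γ : Type*} [Group Γ] {X : Type*} [MeasurableSpace X] [MulAction Γ X] {μ : Measure X}

theorem exists_measure_eq_smul_ne_zero [Countable Γ] (T : preFullGroup Γ μ) (hT : μ (autSupport T.1) ≠ 0) :
    ∃ a : Γ, a ≠ 1 ∧ μ {x | T.1 x = a • x} ≠ 0 := by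
  by_contra! hc
  apply hT
  have h1 : ∀ᵐ x ∂μ, ∀ a : Γ, a ≠ 1 → ¬ T.1 x = a • x := by
    rw [ae_all_iff]
    intro a
    by_cases ha : a = 1
    · simp [ha]
    · have := hc a ha
      rw [ae_iff]
      simpa [ha] using this
  have h2 : ∀ᵐ x ∂μ, T.1 x = x := by
    filter_upwards [h1, T.2.2.2] with x hx ⟨a, ha⟩
    by_cases h : a = 1
    · rw [← ha, h]
      exact one_smul Γ x
    · exact absurd ha.symm (hx a h)
  exact h2

variable [StandardBorelSpace X]

theorem measurableSet_autSupport (T : preFullGroup Γ μ) : MeasurableSet (autSupport T.1) :=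
  (measurableSet_eq_fun T.2.1.measurable measurable_id).compl

variable [MeasurableConstSMul Γ X]

theorem measurableSet_eq_smul (T : preFullGroup Γ μ) (a : Γ) :
    MeasurableSet {x | T.1 x = a • x} :=
  measurableSet_eq_fun T.2.1.measurable (measurable_const_smul a)

/-- A torsion-free group acts essentially freely if it acts faithfully and mixingly. -/
theorem IsMixing.isEssentiallyFree [SMulInvariantMeasure Γ X μ] [IsProbabilityMeasure μ]
    (h : IsMixing Γ μ) (hΓ : IsTorsionFreeGroup Γ) (hfaithful : IsFaithfulAction Γ μ) :
    IsEssentiallyFree Γ μ := by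
  intro a ha
  have hB : MeasurableSet {x : X | a • x = x} :=
    measurableSet_eq_fun (measurable_const_smul a) measurable_id
  -- The fixed-point set of `a` is `a`-invariant, hence null or conull; faithfulness excludes the
  -- latter.
  have h1 := h.measureReal_eq_mul_self (fun h => ha (hΓ a h)) hB (ae_of_all _ fun x => by
    simp only [Set.mem_ofPred_eq, smul_left_cancel_iff])
  have h2 : μ.real {x : X | a • x = x} ≠ 1 := by
    intro h2
    refine ha (hfaithful a ?_)
    exact (mem_ae_iff_prob_eq_one hB).mpr ((ENNReal.toReal_eq_one_iff _).mp h2)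
  have h3 : μ.real {x : X | a • x = x} = 0 := by
    by_contra h3
    exact h2 (mul_left_cancel₀ h3 (by rw [mul_one]; exact h1.symm))
  rw [measureReal_eq_zero_iff] at h3
  rw [ae_iff]
  simpa using h3

/-- Up to small measure, an element of the full group uses only finitely many group elements. -/
theorem exists_finset_measureReal_lt [Countable Γ] [IsFiniteMeasure μ] (T : preFullGroup Γ μ) {ε : ℝ}
    (hε : 0 < ε) : ∃ J : Finset Γ, μ.real {x | ∀ b ∈ J, T.1 x ≠ b • x} < ε := by
  have hlim := tendsto_measure_iInter_atTop (μ := μ)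
    (s := fun J : Finset Γ => {x | ∀ b ∈ J, T.1 x ≠ b • x})
    (fun J => by
      have : {x | ∀ b ∈ J, T.1 x ≠ b • x} = ⋂ b ∈ J, {x | T.1 x = b • x}ᶜ := by
        ext x
        simp
      rw [this]
      exact (J.measurableSet_biInter fun b _ =>
        (measurableSet_eq_smul T b).compl).nullMeasurableSet)
    (fun J K hJK x hx b hb => hx b (hJK hb)) ⟨∅, measure_ne_top _ _⟩
  have hzero : μ (⋂ J : Finset Γ, {x | ∀ b ∈ J, T.1 x ≠ b • x}) = 0 := by
    refine measure_mono_null ?_ T.2.2.2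
    intro x hx ⟨a, ha⟩
    exact Set.mem_iInter.mp hx {a} a (Finset.mem_singleton_self a) ha.symm
  rw [hzero] at hlim
  obtain ⟨J, hJ⟩ := (hlim.eventually_lt_const (ENNReal.ofReal_pos.mpr hε)).exists
  exact ⟨J, (ENNReal.lt_ofReal_iff_toReal_lt (measure_ne_top _ _)).mp hJ⟩

end Supports

/-! ### Conjugates that do not commute. -/

section Noncommuting

variable {Γ : Type*} [Group Γ] [Countable Γ] {X : Type*} [MeasurableSpace X]
  [StandardBorelSpace X] [MulAction Γ X] {μ : Measure X} [MeasurableConstSMul Γ X]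
  [SMulInvariantMeasure Γ X μ] [IsProbabilityMeasure μ]

/-- Noncommuting conjugates in a mixing action of a torsion-free group. -/
theorem IsMixing.exists_not_commute (h : IsMixing Γ μ) (hΓ : IsTorsionFreeGroup Γ)
    (T : preFullGroup Γ μ) (hpos : μ.real (autSupport T.1) ≠ 0)
    (hlt : μ.real (autSupport T.1) < 1) {δ : ℝ} (hδ : 0 < δ) :
    ∃ γ : Γ, μ.real (γ • autSupport T.1 ∩ autSupport T.1) < μ.real (autSupport T.1) ^ 2 + δ ∧
      ¬ ∀ᵐ x ∂μ, T.1 (γ • T.1 (γ⁻¹ • x)) = γ • T.1 (γ⁻¹ • T.1 x) := by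
  classical
  by_contra! hc
  set S := autSupport T.1 with hS
  have hSm : MeasurableSet S := measurableSet_autSupport T
  obtain ⟨a, ha, haA⟩ := exists_measure_eq_smul_ne_zero T
    fun h0 => hpos (by rw [measureReal_eq_zero_iff]; exact h0)
  set A := {x | T.1 x = a • x} with hA
  have hAm : MeasurableSet A := measurableSet_eq_smul T a
  have hA0 : 0 < μ.real A :=
    measureReal_nonneg.lt_of_ne' fun h0 => haA ((measureReal_eq_zero_iff).mp h0)
  have hafin : ¬ IsOfFinOrder a := fun h => ha (hΓ a h)
  have hS'm : MeasurableSet (S ∩ a⁻¹ • S) := hSm.inter (hSm.const_smul _)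
  have heq : μ.real S = μ.real (S ∩ a⁻¹ • S) := by
    have key : μ.real S * μ.real A = μ.real (S ∩ a⁻¹ • S) * μ.real A := by
      refine eq_of_forall_dist_le fun ε hε => ?_
      obtain ⟨F₁, hF₁⟩ := h S S hSm hSm δ hδ
      obtain ⟨F₂, hF₂⟩ := h S A hSm hAm (ε / 2) (half_pos hε)
      obtain ⟨F₃, hF₃⟩ := h (S ∩ a⁻¹ • S) A hS'm hAm (ε / 2) (half_pos hε)
      -- Powers of `a` escape every finite set and commute with `a`.
      obtain ⟨n, hn⟩ := exists_pow_notMem_of_not_isOfFinOrder hafin (F₁ ∪ F₂ ∪ F₃)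
      simp only [Finset.mem_union, not_or] at hn
      have h1 := abs_lt.mp (hF₁ _ hn.1.1)
      have h2 := hF₂ _ hn.1.2
      have h3 := hF₃ _ hn.2
      have hcomm := hc (a ^ n) (by nlinarith)
      -- Commutation makes `T` preserve the support `aⁿS` of the conjugate. On `A` this says that
      -- `a` maps points of `aⁿS` into `aⁿS`.
      have h4 : μ.real (a ^ n • S ∩ A) = μ.real (a ^ n • (S ∩ a⁻¹ • S) ∩ A) := by
        apply measureReal_congr
        filter_upwards [hcomm] with x hx
        change (x ∈ a ^ n • S ∩ A) = (x ∈ a ^ n • (S ∩ a⁻¹ • S) ∩ A)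
        simp only [Set.mem_inter_iff, Set.mem_smul_set_iff_inv_smul_mem, inv_inv, eq_iff_iff]
        refine ⟨fun ⟨hxS, hxA⟩ => ⟨⟨hxS, ?_⟩, hxA⟩, fun ⟨hxS, hxA⟩ => ⟨hxS.1, hxA⟩⟩
        have hxA' : T.1 x = a • x := hxA
        have hswap : a • (a ^ n)⁻¹ • x = (a ^ n)⁻¹ • T.1 x := by
          rw [hxA', smul_smul, smul_smul]
          congr 1
          exact ((Commute.refl a).pow_right n).inv_right.eq
        rw [hswap]
        intro hfix
        rw [hfix, smul_inv_smul] at hx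
        apply hxS
        have := T.1.injective hx
        rw [← eq_inv_smul_iff] at this
        exact this
      rw [h4] at h2
      rw [abs_sub_comm] at h2
      rw [Real.dist_eq]
      calc _ ≤ _ := abs_sub_le _ (μ.real (a ^ n • (S ∩ a⁻¹ • S) ∩ A)) _
        _ ≤ ε := by linarith
    exact mul_right_cancel₀ hA0.ne' key
  -- The intersection has full measure in both `S` and `a⁻¹S`, so `S` is `a`-invariant.
  have h1 : (S ∩ a⁻¹ • S : Set X) =ᵐ[μ] S := by
    refine ae_eq_of_subset_of_measure_ge Set.inter_subset_left ?_ hS'm.nullMeasurableSet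
      (measure_ne_top _ _)
    rw [measureReal_def, measureReal_def, ENNReal.toReal_eq_toReal_iff'
      (measure_ne_top _ _) (measure_ne_top _ _)] at heq
    exact heq.le
  have h2 : (S ∩ a⁻¹ • S : Set X) =ᵐ[μ] (a⁻¹ • S : Set X) := by
    refine ae_eq_of_subset_of_measure_ge Set.inter_subset_right ?_ hS'm.nullMeasurableSet
      (measure_ne_top _ _)
    rw [← measureReal_smul_set a⁻¹, measureReal_def, measureReal_def, ENNReal.toReal_eq_toReal_iff'
      (measure_ne_top _ _) (measure_ne_top _ _)] at heq
    exact heq.le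
  have h3 := h.measureReal_eq_mul_self hafin hSm (by
    filter_upwards [h1.symm.trans h2] with x hx
    have hx' : (x ∈ S) = (x ∈ a⁻¹ • S) := hx
    rw [hx', Set.mem_smul_set_iff_inv_smul_mem, inv_inv])
  exact hlt.ne (mul_left_cancel₀ hpos (by rw [mul_one]; exact h3.symm))

/-- Noncommuting conjugates in a weakly mixing essentially free action of a mixed identity free
group. -/
theorem IsMIF.exists_not_commute (hΓ : IsMIF Γ) (hwm : IsWeaklyMixing Γ μ)
    (hfree : IsEssentiallyFree Γ μ) (T : preFullGroup Γ μ)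
    (hpos : μ.real (autSupport T.1) ≠ 0) {δ : ℝ} (hδ : 0 < δ) :
    ∃ γ : Γ, μ.real (γ • autSupport T.1 ∩ autSupport T.1) < μ.real (autSupport T.1) ^ 2 + δ ∧
      ¬ ∀ᵐ x ∂μ, T.1 (γ • T.1 (γ⁻¹ • x)) = γ • T.1 (γ⁻¹ • T.1 x) := by
  classical
  by_contra! hc
  set S := autSupport T.1 with hS
  have hSm : MeasurableSet S := measurableSet_autSupport T
  obtain ⟨a, ha, haA⟩ := exists_measure_eq_smul_ne_zero T
    fun h0 => hpos (by rw [measureReal_eq_zero_iff]; exact h0)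
  set A := {x | T.1 x = a • x} with hA
  have hAm : MeasurableSet A := measurableSet_eq_smul T a
  have hA0 : 0 < μ.real A :=
    measureReal_nonneg.lt_of_ne' fun h0 => haA ((measureReal_eq_zero_iff).mp h0)
  have hA2 : 0 < μ.real A * μ.real A := mul_pos hA0 hA0
  have : Nontrivial Γ := ⟨a, 1, ha⟩
  -- Two preimages of `E` must be excluded below; a quarter each keeps their total under the lower
  -- bound `μ(A)² / 2` for `μ(γA ∩ A)`.
  obtain ⟨J, hJ⟩ := exists_finset_measureReal_lt T (ε := μ.real A * μ.real A / 4) (by positivity)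
  set E := {x | ∀ b ∈ J, T.1 x ≠ b • x} with hE
  have hEm : MeasurableSet E := by
    have : E = ⋂ b ∈ J, {x | T.1 x = b • x}ᶜ := by
      ext x
      simp [E]
    rw [this]
    exact J.measurableSet_biInter fun b _ => (measurableSet_eq_smul T b).compl
  obtain ⟨U, hU⟩ := hwm.syndetic (fun k : Bool => cond k A S)
    (by rintro (_ | _) <;> assumption) (δ := min δ (μ.real A * μ.real A / 2))
    (lt_min hδ (by positivity))
  have hfree' : ∀ᵐ x ∂μ, ∀ g : Γ, g • x = x → g = 1 := by
    rw [ae_all_iff]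
    intro g
    by_cases hg : g = 1
    · simp [hg]
    · filter_upwards [hfree g hg] with x hx h
      exact absurd h hx
  -- The equation `bγaγ⁻¹ = γdγ⁻¹a` with `γ = ug`, conjugated by `u⁻¹` and read as a word in `g`.
  -- `U` is fixed before `g`, so the family of words is finite.
  obtain ⟨g, hg⟩ := hΓ.exists_forall_mixedEval_ne_one (U ×ˢ J ×ˢ J)
    (fun p => doubleConjWord a (p.1⁻¹ * a⁻¹ * p.1) (p.1⁻¹ * p.2.1 * p.1) p.2.2⁻¹)
    (fun p _ => doubleConjWord_ne_one ha
      (by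
        intro h
        apply ha
        have h' : a⁻¹ = 1 := by simpa using (conj_eq_one_iff (a := p.1⁻¹) (b := a⁻¹)).mp (by
          simpa using h)
        simpa using h') _ _)
  obtain ⟨u, hu, huk⟩ := hU g
  set γ := u * g with hγ
  have hcomm := hc γ (by
    have := (abs_lt.mp ((huk false).trans_le (min_le_left _ _))).2
    simp only [cond_false] at this
    nlinarith)
  have hlow : μ.real A * μ.real A / 2 < μ.real (γ • A ∩ A) := by
    have := (abs_lt.mp ((huk true).trans_le (min_le_right _ _))).1
    simp only [cond_true] at this
    linarith
  have hγp : ∀ γ : Γ, MeasurePreserving (fun x : X => γ • x) μ μ := fun γ =>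
    measurePreserving_smul γ μ
  have hE₁ : μ.real ((fun x => γ • T.1 (γ⁻¹ • x)) ⁻¹' E) = μ.real E :=
    ((hγp γ).comp (T.2.1.comp (hγp γ⁻¹))).measureReal_preimage hEm.nullMeasurableSet
  have hE₂ : μ.real ((fun x => γ⁻¹ • T.1 x) ⁻¹' E) = μ.real E :=
    ((hγp γ⁻¹).comp T.2.1).measureReal_preimage hEm.nullMeasurableSet
  have hne : ∃ x ∈ γ • A ∩ A, γ • T.1 (γ⁻¹ • x) ∉ E ∧ γ⁻¹ • T.1 x ∉ E ∧
      T.1 (γ • T.1 (γ⁻¹ • x)) = γ • T.1 (γ⁻¹ • T.1 x) ∧ ∀ g : Γ, g • x = x → g = 1 := by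
    by_contra! hno
    have hsub : (γ • A ∩ A : Set X) ≤ᵐ[μ]
        ((fun x => γ • T.1 (γ⁻¹ • x)) ⁻¹' E ∪ (fun x => γ⁻¹ • T.1 x) ⁻¹' E : Set X) := by
      filter_upwards [hcomm, hfree'] with x h1 h2 hx
      by_contra hx'
      change ¬ (_ ∨ _) at hx'
      rw [not_or] at hx'
      obtain ⟨g, hg1, hg2⟩ := hno x hx hx'.1 hx'.2 h1
      exact hg2 (h2 g hg1)
    have h1 : μ.real (γ • A ∩ A) ≤ _ :=
      ENNReal.toReal_mono (measure_ne_top _ _) (measure_mono_ae hsub)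
    have h2 := measureReal_union_le (μ := μ) ((fun x => γ • T.1 (γ⁻¹ • x)) ⁻¹' E)
      ((fun x => γ⁻¹ • T.1 x) ⁻¹' E)
    rw [hE₁, hE₂] at h2
    have h3 := h1.trans h2
    linarith
  obtain ⟨x, ⟨hx₁, hx₂⟩, hy, hz, hxc, hxf⟩ := hne
  rw [Set.mem_smul_set_iff_inv_smul_mem] at hx₁
  simp only [hE, Set.mem_ofPred_eq, not_forall, not_not] at hy hz
  obtain ⟨b, hb, hyb⟩ := hy
  obtain ⟨d, hd, hzd⟩ := hz
  rw [hyb, hzd, show T.1 (γ⁻¹ • x) = a • γ⁻¹ • x from hx₁,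
    show T.1 x = a • x from hx₂] at hxc
  simp only [smul_smul] at hxc
  have hrel := hxf ((γ * (d * (γ⁻¹ * a)))⁻¹ * (b * (γ * (a * γ⁻¹)))) (by
    rw [mul_smul, inv_smul_eq_iff]
    exact hxc)
  refine hg (u, b, d) (by simp [hu, hb, hd]) ?_
  rw [mixedEval_doubleConjWord]
  rw [inv_mul_eq_one] at hrel
  have hg' : g = u⁻¹ * γ := by rw [hγ, inv_mul_cancel_left]
  calc _ = u⁻¹ * (b * (γ * (a * γ⁻¹)) * (γ * (d * (γ⁻¹ * a)))⁻¹) * u := by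
        rw [hg']
        group
    _ = 1 := by rw [← hrel]; group

end Noncommuting

end

noncomputable section

/-! ### Lengths of commutators. -/

section Commutators

variable {Γ : Type*} [Group Γ] {X : Type*} [MeasurableSpace X] [MulAction Γ X] {μ : Measure X}

/-- If `x`, `S⁻¹x` and `T⁻¹x` avoid the common support, each of them is fixed by `S` or by `T`, and
in every case the commutator returns `x` to itself. -/
theorem autSupport_commutator_subset {X : Type*} (S T : Equiv.Perm X) :
    autSupport (S * T * S⁻¹ * T⁻¹) ⊆ autSupport S ∩ autSupport T ∪
      (⇑S⁻¹ ⁻¹' (autSupport S ∩ autSupport T) ∪ ⇑T⁻¹ ⁻¹' (autSupport S ∩ autSupport T)) := by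
  intro x hx
  by_contra hc
  have hSS : S (S⁻¹ x) = x := S.apply_symm_apply x
  have hTT : T (T⁻¹ x) = x := T.apply_symm_apply x
  simp only [Set.mem_union, Set.mem_preimage, Set.mem_inter_iff, autSupport, Set.mem_ofPred_eq,
    not_or, not_and, not_not, hSS, hTT] at hc
  obtain ⟨h1, h2, h3⟩ := hc
  apply hx
  change S (T (S⁻¹ (T⁻¹ x))) = x
  by_cases hT : T x = x
  · rw [Equiv.Perm.inv_eq_iff_eq.mpr hT.symm]
    by_cases hS : x = S⁻¹ x
    · rw [← hS, hT, ← Equiv.Perm.inv_eq_iff_eq.mp hS.symm]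
    · rw [h2 hS, hSS]
  · have hS : S x = x := by
      by_contra hS
      exact hT (h1 hS)
    have hST : S (T⁻¹ x) = T⁻¹ x := by
      by_contra h
      exact hT (Equiv.Perm.inv_eq_iff_eq.mp (h3 h).symm).symm
    rw [Equiv.Perm.inv_eq_iff_eq.mpr hST.symm, hTT, hS]

variable [StandardBorelSpace X] [IsProbabilityMeasure μ]

theorem suppMeasure_commutator_le (S T : preFullGroup Γ μ) :
    suppMeasure (FullGroup.mk Γ μ (S * T * S⁻¹ * T⁻¹)) ≤
      3 * μ.real (autSupport S.1 ∩ autSupport T.1) := by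
  have hI : NullMeasurableSet (autSupport S.1 ∩ autSupport T.1) μ :=
    ((measurableSet_autSupport S).inter (measurableSet_autSupport T)).nullMeasurableSet
  rw [suppMeasure_mk]
  calc _ ≤ _ := measureReal_mono (autSupport_commutator_subset S.1 T.1)
    _ ≤ _ := measureReal_union_le _ _
    _ ≤ _ := add_le_add_right (measureReal_union_le _ _) _
    _ = _ := by
      rw [S.2.2.1.measureReal_preimage hI, T.2.2.1.measureReal_preimage hI]
      ring

variable [MeasurableConstSMul Γ X] [SMulInvariantMeasure Γ X μ]

/-- If supports can be made almost independent by noncommuting conjugates, then an element of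
small support has small nontrivial commutators with its conjugates. -/
theorem exists_commutator_ne_one
    (hnc : ∀ T : preFullGroup Γ μ, μ.real (autSupport T.1) ≠ 0 → μ.real (autSupport T.1) < 1 →
      ∀ δ : ℝ, 0 < δ → ∃ γ : Γ,
        μ.real (γ • autSupport T.1 ∩ autSupport T.1) < μ.real (autSupport T.1) ^ 2 + δ ∧
        ¬ ∀ᵐ x ∂μ, T.1 (γ • T.1 (γ⁻¹ • x)) = γ • T.1 (γ⁻¹ • T.1 x))
    {g : FullGroup Γ μ} (hg : g ≠ 1) (hg1 : suppMeasure g < 1) {δ : ℝ} (hδ : 0 < δ) :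
    ∃ c ∈ (toFullGroup Γ μ).range, ∃ k, k = c * g * c⁻¹ ∧ g * k * g⁻¹ * k⁻¹ ≠ 1 ∧
      suppMeasure (g * k * g⁻¹ * k⁻¹) ≤ 3 * (suppMeasure g ^ 2 + δ) := by
  obtain ⟨T, rfl⟩ := FullGroup.mk_surjective g
  obtain ⟨γ, hγ, hγc⟩ := hnc T (fun h => hg (eq_one_of_suppMeasure_eq_zero _ h)) hg1 δ hδ
  obtain ⟨P, hP, hPx⟩ : ∃ P : preFullGroup Γ μ, FullGroup.mk Γ μ P = toFullGroup Γ μ γ ∧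
      P.1 = MulAction.toPerm γ := ⟨_, rfl, rfl⟩
  have hCx : ∀ x, (P * T * P⁻¹).1 x = γ • T.1 (γ⁻¹ • x) := by
    intro x
    change P.1 (T.1 (P.1⁻¹ x)) = _
    rw [hPx]
    rfl
  have hCs : autSupport (P * T * P⁻¹).1 = γ • autSupport T.1 := by
    ext x
    rw [Set.mem_smul_set_iff_inv_smul_mem]
    change (P * T * P⁻¹).1 x ≠ x ↔ T.1 (γ⁻¹ • x) ≠ γ⁻¹ • x
    rw [hCx, ne_eq, ne_eq, eq_inv_smul_iff]
  refine ⟨_, ⟨γ, rfl⟩, FullGroup.mk Γ μ (P * T * P⁻¹), by simp [hP], ?_, ?_⟩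
  · intro h
    apply hγc
    rw [mul_inv_eq_one, mul_inv_eq_iff_eq_mul, ← map_mul, ← map_mul] at h
    have h1 := QuotientGroup.eq.mp h.symm
    filter_upwards [show ∀ᵐ x ∂μ,
      ((P * T * P⁻¹) * T).1⁻¹ ((T * (P * T * P⁻¹)).1 x) = x from h1] with x hx
    rw [Equiv.Perm.inv_eq_iff_eq] at hx
    change T.1 ((P * T * P⁻¹).1 x) = (P * T * P⁻¹).1 (T.1 x) at hx
    rwa [hCx, hCx] at hx
  · have := suppMeasure_commutator_le T (P * T * P⁻¹)
    rw [hCs, Set.inter_comm] at this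
    simp only [map_mul, map_inv] at this ⊢
    rw [suppMeasure_mk]
    linarith

end Commutators

/-! ### Discreteness as a gap in length, and Zorn's lemma. -/

section Discreteness

variable {Γ : Type*} [Group Γ] {X : Type*} [MeasurableSpace X] [MulAction Γ X] {μ : Measure X}
  [IsProbabilityMeasure μ]

theorem IsDiscreteSubgroup.exists_le_suppMeasure {Λ : Subgroup (FullGroup Γ μ)}
    (h : IsDiscreteSubgroup Λ) : ∃ ε > 0, ∀ g ∈ Λ, g ≠ 1 → ε ≤ suppMeasure g := by
  have : DiscreteTopology Λ := h
  obtain ⟨ε, hε, hball⟩ := Metric.isOpen_iff.mp (isOpen_discrete ({1} : Set Λ)) 1 rfl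
  refine ⟨ε, hε, fun g hg hg1 => ?_⟩
  by_contra! hlt
  have hmem : (⟨g, hg⟩ : Λ) ∈ Metric.ball (1 : Λ) ε := by
    change suppMeasure (g * 1⁻¹) < ε
    rwa [inv_one, mul_one]
  exact hg1 (congrArg Subtype.val (hball hmem))

theorem isDiscreteSubgroup_of_le_suppMeasure {Λ : Subgroup (FullGroup Γ μ)} {ε : ℝ} (hε : 0 < ε)
    (h : ∀ g ∈ Λ, g ≠ 1 → ε ≤ suppMeasure g) : IsDiscreteSubgroup Λ := by
  refine DiscreteTopology.of_forall_le_dist hε fun g k hgk => ?_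
  change ε ≤ suppMeasure (g.1 * k.1⁻¹)
  exact h _ (Λ.mul_mem g.2 (Λ.inv_mem k.2)) fun h1 => hgk (Subtype.ext (mul_inv_eq_one.mp h1))

/-- If the discrete subgroups above `Λ₀` are uniformly discrete, then a maximal discrete subgroup
lies above `Λ₀`. -/
theorem exists_le_maximal_isDiscreteSubgroup {Λ₀ : Subgroup (FullGroup Γ μ)}
    (h₀ : IsDiscreteSubgroup Λ₀) {ε : ℝ} (hε : 0 < ε)
    (h : ∀ Λ, Λ₀ ≤ Λ → IsDiscreteSubgroup Λ → ∀ g ∈ Λ, g ≠ 1 → ε ≤ suppMeasure g) :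
    ∃ Λ, Λ₀ ≤ Λ ∧ Maximal (fun Λ' : Subgroup (FullGroup Γ μ) => IsDiscreteSubgroup Λ') Λ := by
  obtain ⟨Λ, hle, hmax⟩ := zorn_le_nonempty₀ {Λ | Λ₀ ≤ Λ ∧ IsDiscreteSubgroup Λ} (by
    intro c hc hchain y hy
    refine ⟨sSup c, ⟨(hc hy).1.trans (le_sSup hy), ?_⟩, fun z hz => le_sSup hz⟩
    -- Each element of the union lies in one member of the chain, where the common bound `ε`
    -- applies.
    refine isDiscreteSubgroup_of_le_suppMeasure hε fun g hg hg1 => ?_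
    obtain ⟨Λ, hΛc, hgΛ⟩ := (Subgroup.mem_sSup_of_directedOn ⟨y, hy⟩ hchain.directedOn).mp hg
    exact h Λ (hc hΛc).1 (hc hΛc).2 g hgΛ hg1) Λ₀ ⟨le_rfl, h₀⟩
  exact ⟨Λ, hle, hmax.1.2, fun Λ' hΛ' hΛΛ' => hmax.2 ⟨hle.trans hΛΛ', hΛ'⟩ hΛΛ'⟩

variable [MeasurableConstSMul Γ X] [SMulInvariantMeasure Γ X μ]

/-- Nontrivial elements of `Γ` move almost every point, so they have length 1. -/
theorem IsEssentiallyFree.isDiscreteSubgroup (h : IsEssentiallyFree Γ μ) :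
    IsDiscreteSubgroup (groupInFullGroup Γ μ) := by
  refine isDiscreteSubgroup_of_le_suppMeasure one_pos ?_
  rintro _ ⟨γ, rfl⟩ hγ
  have hae := h γ fun h1 => hγ (by rw [h1, map_one])
  have : μ (autSupport (MulAction.toPerm γ : Equiv.Perm X)) = 1 := by
    rw [← measure_univ (μ := μ)]
    exact measure_congr (Filter.eventuallyEq_univ.mpr hae)
  change 1 ≤ μ.real (autSupport (MulAction.toPerm γ : Equiv.Perm X))
  rw [measureReal_def, this, ENNReal.toReal_one]

end Discreteness

end

/-! ### The main theorem. -/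

theorem theorem1p1 {Γ : Type*} [Group Γ] [Countable Γ]
    {X : Type*} [MeasurableSpace X] [StandardBorelSpace X]
    (μ : Measure X) [IsProbabilityMeasure μ]
    [MulAction Γ X] [MeasurableConstSMul Γ X] [SMulInvariantMeasure Γ X μ]
    (hfaithful : IsFaithfulAction Γ μ)
    (h : (IsMIF Γ ∧ IsWeaklyMixing Γ μ ∧ IsEssentiallyFree Γ μ) ∨
      (IsTorsionFreeGroup Γ ∧ IsMixing Γ μ)) :
    (∀ g : FullGroup Γ μ, g ≠ 1 → suppMeasure g < 1 / 3 →
      ¬ IsDiscreteSubgroup (groupInFullGroup Γ μ ⊔ Subgroup.zpowers g)) ∧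
    ∃ Λ : Subgroup (FullGroup Γ μ), groupInFullGroup Γ μ ≤ Λ ∧
      Maximal (fun Λ' : Subgroup (FullGroup Γ μ) => IsDiscreteSubgroup Λ') Λ := by
  have hfree : IsEssentiallyFree Γ μ := by
    rcases h with h | h
    · exact h.2.2
    · exact h.2.isEssentiallyFree h.1 hfaithful
  have hnc : ∀ T : preFullGroup Γ μ, μ.real (autSupport T.1) ≠ 0 → μ.real (autSupport T.1) < 1 →
      ∀ δ : ℝ, 0 < δ → ∃ γ : Γ,
        μ.real (γ • autSupport T.1 ∩ autSupport T.1) < μ.real (autSupport T.1) ^ 2 + δ ∧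
        ¬ ∀ᵐ x ∂μ, T.1 (γ • T.1 (γ⁻¹ • x)) = γ • T.1 (γ⁻¹ • T.1 x) := by
    intro T h0 h1 δ hδ
    rcases h with h | h
    · exact h.1.exists_not_commute h.2.1 hfree T h0 hδ
    · exact h.2.exists_not_commute h.1 T h0 h1 hδ
  have hlarge : ∀ Λ, groupInFullGroup Γ μ ≤ Λ → IsDiscreteSubgroup Λ →
      ∀ g ∈ Λ, g ≠ 1 → 1 / 3 ≤ suppMeasure g := by
    intro Λ hΓΛ hΛ g hg hg1
    by_contra! hlt
    obtain ⟨ε, hε, hεΛ⟩ := hΛ.exists_le_suppMeasure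
    let L : Set ℝ := suppMeasure '' {k | k ∈ Λ ∧ k ≠ 1}
    have hLne : L.Nonempty := ⟨_, g, ⟨hg, hg1⟩, rfl⟩
    have hLbdd : BddBelow L := ⟨ε, by
      rintro _ ⟨k, ⟨hk, hk1⟩, rfl⟩
      exact hεΛ k hk hk1⟩
    have hc0 : 0 < sInf L := hε.trans_le (le_csInf hLne (by
      rintro _ ⟨k, ⟨hk, hk1⟩, rfl⟩
      exact hεΛ k hk hk1))
    have hc1 : sInf L < 1 / 3 := (csInf_le hLbdd ⟨g, ⟨hg, hg1⟩, rfl⟩).trans_lt hlt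
    -- For `c = sInf L > 0`, `c² < c / 3` is exactly `c < 1 / 3`.
    have hcs : sInf L < √(sInf L / 3) := Real.lt_sqrt_of_sq_lt (by nlinarith)
    obtain ⟨_, ⟨k, ⟨hk, hk1⟩, rfl⟩, hkc⟩ := exists_lt_of_csInf_lt hLne hcs
    have hk0 : 0 ≤ suppMeasure k := hε.le.trans (hεΛ k hk hk1)
    have hksq : suppMeasure k ^ 2 < sInf L / 3 := (Real.lt_sqrt hk0).mp hkc
    have hklt : suppMeasure k < 1 := by nlinarith
    -- This `δ` makes the commutator bound the midpoint of `3 ℓ(k)²` and `sInf L`, hence less than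
    -- `sInf L`.
    obtain ⟨c, hcΓ, m, rfl, hm1, hm⟩ := exists_commutator_ne_one hnc hk1 hklt
      (δ := (sInf L / 3 - suppMeasure k ^ 2) / 2) (by linarith)
    have hcΛ : c ∈ Λ := hΓΛ hcΓ
    have hmΛ : c * k * c⁻¹ ∈ Λ := Λ.mul_mem (Λ.mul_mem hcΛ hk) (Λ.inv_mem hcΛ)
    have := csInf_le hLbdd ⟨_, ⟨Λ.mul_mem (Λ.mul_mem (Λ.mul_mem hk hmΛ) (Λ.inv_mem hk))
      (Λ.inv_mem hmΛ), hm1⟩, rfl⟩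
    linarith
  refine ⟨fun g hg1 hg hΛ => ?_,
    exists_le_maximal_isDiscreteSubgroup hfree.isDiscreteSubgroup (by norm_num) hlarge⟩
  have := hlarge _ le_sup_left hΛ g (Subgroup.mem_sup_right (Subgroup.mem_zpowers g)) hg1
  linarith
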